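/- A \emph{weighted graph} $\Gamma=(V\Gamma,E\Gamma,m)$ is a simple graph $(V\Gamma,E\Gamma)$ with a weight $m\colon V\Gamma\times V\Gamma\to\{1,2,\dots\}\cup\{+\infty\}$ such that, for all $x,y\in V\Gamma$, $m(x,y)=m(y,x)$; $m(x,y)=1$ if and only if $x=y$; and, for $x\neq y$, $m(x,y)=+\infty$ if and only if $\{x,y\}\notin E\Gamma$. Let $\mathrm{Aut}(\Gamma)$ be the group of bijections of $V\Gamma$ preserving $m$, and let $\mathrm{star}(x)$ be the set consisting of $x$ and its neighbours in $\Gamma$. Let $W_\Gamma=\langle V\Gamma\mid (xy)^{m(x,y)}=e \text{ for all } x,y\in V\Gamma \text{ with } m(x,y)<+\infty\rangle$ be the associated Coxeter group, let $\mathcal C_\Gamma$ be its (unlabelled, simple) Cayley graph with respect to $V\Gamma$, and let $\mathcal A_\Gamma=\mathrm{Aut}(\mathcal C_\Gamma)$ be the group of all graph automorphisms of $\mathcal C_\Gamma$, with the permutation topology: a set $U\subseteq\mathcal A_\Gamma$ is open if and only if for each $g\in U$ there is a finite set $F$ of vertices of $\mathcal C_\Gamma$ such that every $f\in\mathcal A_\Gamma$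 with $f|_F=g|_F$ lies in $U$. \textbf{Corollary A.} Let $\Gamma$ be a finite weighted graph. Then $\mathcal A_\Gamma$ is a totally disconnected locally compact (TDLC) Hausdorff topological group, and it is non-discrete if and only if there exist a vertex $x\in V\Gamma$ and a non-trivial automorphism $\alpha\in\mathrm{Aut}(\Gamma)$ such that $\alpha|_{\mathrm{star}(x)}=\mathrm{id}$. In particular, $\mathcal A_\Gamma$ is a non-discrete TDLC group if and only if such $x$ and $\alpha$ exist. -/

import Mathlib

/-- A weighted graph with vertex set `V`: a simple graph together with a weight
`m : V × V → {1, 2, …} ∪ {∞}` which is symmetric, equals `1` exactly on the diagonal, and, for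
distinct vertices, is infinite exactly when they are not adjacent. -/
structure WeightedGraph (V : Type*) where
  /-- The underlying simple graph. -/
  graph : SimpleGraph V
  /-- The weight. -/
  m : V → V → ℕ∞
  one_le : ∀ x y, 1 ≤ m x y
  symm : ∀ x y, m x y = m y x
  eq_one_iff : ∀ x y, m x y = 1 ↔ x = y
  eq_top_iff : ∀ x y, x ≠ y → (m x y = ⊤ ↔ ¬ graph.Adj x y)

namespace WeightedGraph

variable {V : Type*} (Γ : WeightedGraph V)

/-- The group `Aut(Γ)` of automorphisms of a weighted graph: the weight-preserving bijections of
the vertex set. -/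
def Aut : Subgroup (Equiv.Perm V) where
  carrier := {σ | ∀ x y, Γ.m (σ x) (σ y) = Γ.m x y}
  one_mem' := fun _ _ => rfl
  mul_mem' := fun {a b} ha hb x y => (ha (b x) (b y)).trans (hb x y)
  inv_mem' := fun {a} ha x y => by
    have h := ha (a⁻¹ x) (a⁻¹ y)
    simpa using h.symm

/-- The star of a vertex: the vertex together with its neighbours. -/
def star (x : V) : Set V := insert x (Γ.graph.neighborSet x)

/-- The Coxeter matrix of a weighted graph. Mathlib encodes the absence of a relation (weight `∞`)
by the entry `0`, and `ENat.toNat` sends `∞` to `0` and is the identity on finite weights. -/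
def coxeterMatrix : CoxeterMatrix V where
  M := Matrix.of fun x y => (Γ.m x y).toNat
  isSymm := by
    ext x y
    simp [Matrix.transpose_apply, Γ.symm x y]
  diagonal x := by
    simp [(Γ.eq_one_iff x x).2 rfl]
  off_diagonal x y h h1 := by
    have h1' : (Γ.m x y).toNat = 1 := h1
    exact h ((Γ.eq_one_iff x y).1 ((ENat.toNat_eq_iff one_ne_zero).1 h1'))

/-- The Coxeter group `W_Γ = ⟨V | (xy)^{m(x,y)} = e for all x, y with m(x,y) < ∞⟩`. -/
abbrev CoxeterGroup : Type _ := Γ.coxeterMatrix.Group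

/-- The Cayley graph of `W_Γ` with respect to the standard generating set `V`: an unlabelled simple
graph, in which `v ≠ w` are adjacent iff `w = v * x` or `v = w * x` for some generator `x`. -/
def cayleyGraph : SimpleGraph Γ.CoxeterGroup :=
  SimpleGraph.mulCayley (Set.range Γ.coxeterMatrix.simple)

/-- The group `𝒜_Γ` of all graph automorphisms of the Cayley graph (labels need not be
preserved); multiplication is composition. -/
abbrev CayleyAut : Type _ := Γ.cayleyGraph ≃g Γ.cayleyGraph

end WeightedGraph

/-- The permutation topology on a group `G` acting on a set `X`: a set `U` is open iff for every
`g ∈ U` there is a finite `F ⊆ X` such that `U` contains every `f ∈ G` that agrees with `g` on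
`F`. -/
abbrev permutationTopology (G X : Type*) [Group G] [MulAction G X] : TopologicalSpace G where
  IsOpen U := ∀ g ∈ U, ∃ F : Finset X, ∀ f : G, (∀ x ∈ F, f • x = g • x) → f ∈ U
  isOpen_univ := fun _ _ => ⟨∅, fun _ _ => Set.mem_univ _⟩
  isOpen_inter := by
    classical
    rintro U₁ U₂ h₁ h₂ g ⟨hg₁, hg₂⟩
    obtain ⟨F₁, hF₁⟩ := h₁ g hg₁
    obtain ⟨F₂, hF₂⟩ := h₂ g hg₂
    exact ⟨F₁ ∪ F₂, fun f hf =>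
      ⟨hF₁ f fun x hx => hf x (Finset.mem_union_left _ hx),
       hF₂ f fun x hx => hf x (Finset.mem_union_right _ hx)⟩⟩
  isOpen_sUnion := by
    rintro S hS g ⟨U, hU, hg⟩
    obtain ⟨F, hF⟩ := hS U hU g hg
    exact ⟨F, fun f hf => ⟨U, hU, hF f hf⟩⟩

/-- `𝒜_Γ` carries the permutation topology of its action on the vertices of the Cayley graph. -/
instance WeightedGraph.instTopologicalSpaceCayleyAut {V : Type*} (Γ : WeightedGraph V) :
    TopologicalSpace Γ.CayleyAut :=
  permutationTopology Γ.CayleyAut Γ.CoxeterGroup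

/-- A TDLC group: a totally disconnected, locally compact (Hausdorff) topological group. -/
structure IsTDLCGroup (G : Type*) [Group G] [TopologicalSpace G] : Prop where
  isTopologicalGroup : IsTopologicalGroup G
  t2Space : T2Space G
  totallyDisconnectedSpace : TotallyDisconnectedSpace G
  locallyCompactSpace : LocallyCompactSpace G

/-!
# Discreteness of the automorphism group of the Cayley graph of a Coxeter group

An automorphism `f` of the Cayley graph is described by its local permutations: at each vertex `w`
the edge labelled `x` goes to an edge labelled `label f w x` at `f w`. Two facts about these govern
everything.

* Each local permutation is an automorphism of `Γ` (`CayleyAut.labelPerm_mem_aut`). Indeed, the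
  weight `m x y` can be read off from the metric: it is the least distance from `w` of a vertex `v`
  such that both the edges labelled `x` and `y` at `w` lead towards `v`, in other words such that
  `x` and `y` are right descents of `v⁻¹ * w`. This rests on the fact that an element with the
  right descents `x` and `y` ends with all reduced alternating words in `x` and `y`
  (`CoxeterSystem.exists_eq_mul_alternatingWord`).
* The local permutations at the ends of an edge labelled `x` agree on the star of `x`
  (`CayleyAut.label_mul_simple_of_mem_star`), since the `2 m`-cycle with the labels `x` and `y`
  through that edge goes to a cycle of the same kind.

If only the identity of `Γ` fixes a star pointwise, then an automorphism that fixes the ball of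
radius one has trivial local permutations everywhere, so that the group is discrete
(`CayleyAut.eq_one_of_rigid`).

Conversely, every assignment of automorphisms of `Γ` to the vertices which satisfies the second
condition comes from an automorphism of the Cayley graph fixing `1` (`Labelling.cayleyAut`). The map
is well defined because the condition makes the Coxeter relations hold, and bijective because it
maps every ball about `1`, a finite set, onto itself. Given `α ≠ 1` fixing the star of `x`, assign `α` to
the vertices of one coset of the subgroup generated by all generators but `x`, and the identity to
the others; this is allowed as only edges labelled `x` leave the coset. As `α` moves some `y` with
`m x y = ∞`, there are infinitely many such cosets (`simple_mul_simple_pow_notMem_maximalParabolic`,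
seen in the geometric representation), so the coset can be chosen outside a given ball, which the
resulting automorphism then fixes.

The group is locally compact because the stabilizer of a vertex has finite orbits.

The theory of Coxeter groups that is needed is the geometric representation, which gives the order
of the product of two generators, and the exchange property, which comes from an action on signed
group elements that counts inversions modulo two.
-/

/-! ### The geometric representation -/

section Reflections

variable {E : Type*} [AddCommGroup E] [Module ℝ E] {x y : E} {f g : Module.Dual ℝ E} {θ : ℝ}

open Real in
/-- The iterated product of two reflections rotates the plane spanned by their roots. -/
theorem Module.sin_smul_reflection_mul_reflection_pow_apply (hf : f x = 2) (hg : g y = 2)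
    (hfy : f y = -2 * cos θ) (hgx : g x = -2 * cos θ) (k : ℕ) :
    sin θ • ((Module.reflection hf * Module.reflection hg) ^ k) x =
      sin ((2 * k + 1) * θ) • x + sin (2 * k * θ) • y := by
  induction k with
  | zero => simp
  | succ k ih =>
    rw [pow_succ', LinearEquiv.mul_apply, LinearEquiv.mul_apply, ← map_smul, ← map_smul, ih]
    simp only [Module.reflection_apply, map_add, map_sub, map_smul, hf, hg, hfy, hgx]
    have e1 : sin ((2 * k + 1) * θ) = sin (2 * k * θ) * cos θ + cos (2 * k * θ) * sin θ := by
      rw [← sin_add]; ring_nf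
    have e2 : sin ((2 * ((k + 1 : ℕ) : ℝ)) * θ) =
        sin (2 * k * θ) * cos (2 * θ) + cos (2 * k * θ) * sin (2 * θ) := by
      rw [← sin_add]; push_cast; ring_nf
    have e3 : sin ((2 * ((k + 1 : ℕ) : ℝ) + 1) * θ) =
        sin (2 * k * θ) * cos (3 * θ) + cos (2 * k * θ) * sin (3 * θ) := by
      rw [← sin_add]; push_cast; ring_nf
    rw [e1, e2, e3, cos_three_mul, sin_three_mul, cos_two_mul, sin_two_mul]
    have h3 : sin θ ^ 3 = sin θ * (1 - cos θ ^ 2) := by rw [← sin_sq]; ring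
    rw [h3]
    module

open Real in
/-- Two reflections whose roots meet at an angle with `m * θ = π` satisfy the braid relation of
order `m`. -/
theorem Module.reflection_mul_reflection_pow_eq_one (hf : f x = 2) (hg : g y = 2)
    (hfy : f y = -2 * cos θ) (hgx : g x = -2 * cos θ) (hθ : sin θ ≠ 0) {m : ℕ} (hm : m * θ = π) :
    (Module.reflection hf * Module.reflection hg) ^ m = 1 := by
  have key : ∀ {x y : E} {f g : Module.Dual ℝ E} (hf : f x = 2) (hg : g y = 2)
      (_ : f y = -2 * cos θ) (_ : g x = -2 * cos θ),
      ((Module.reflection hf * Module.reflection hg) ^ m) x = x := by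
    intro x y f g hf hg hfy hgx
    have h := Module.sin_smul_reflection_mul_reflection_pow_apply hf hg hfy hgx m
    have e1 : (2 * (m : ℝ) + 1) * θ = θ + 2 * π := by rw [← hm]; ring
    have e2 : 2 * (m : ℝ) * θ = 2 * π := by rw [← hm]; ring
    rw [e1, e2, sin_add_two_pi, sin_two_pi, zero_smul, add_zero] at h
    exact smul_right_injective E hθ h
  have hx := key hf hg hfy hgx
  have hy : ((Module.reflection hf * Module.reflection hg) ^ m) y = y := by
    have h := key hg hf hgx hfy
    have hinv : (Module.reflection hf * Module.reflection hg) ^ m =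
        ((Module.reflection hg * Module.reflection hf) ^ m)⁻¹ := by
      rw [← inv_pow, mul_inv_rev, Module.reflection_inv, Module.reflection_inv]
    rw [hinv]
    exact (LinearEquiv.symm_apply_eq _).2 h.symm
  have hfix : ∀ v, f v = 0 → g v = 0 →
      ((Module.reflection hf * Module.reflection hg) ^ m) v = v := by
    intro v h1 h2
    generalize m = n
    induction n with
    | zero => simp
    | succ n ih =>
      rw [pow_succ, LinearEquiv.mul_apply, LinearEquiv.mul_apply]
      simp [Module.reflection_apply, h1, h2, ih]
  ext z
  -- As `sin θ ≠ 0`, the plane of `x` and `y` is complemented by `ker f ⊓ ker g`.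
  have hs : 2 * sin θ ^ 2 ≠ 0 := by positivity
  set p := (f z + cos θ * g z) / (2 * sin θ ^ 2) with hp
  set q := (cos θ * f z + g z) / (2 * sin θ ^ 2) with hq
  have hp' : p * (2 * sin θ ^ 2) = f z + cos θ * g z := div_mul_cancel₀ _ hs
  have hq' : q * (2 * sin θ ^ 2) = cos θ * f z + g z := div_mul_cancel₀ _ hs
  have hz : z = (z - p • x - q • y) + p • x + q • y := by abel
  have hcs := sin_sq_add_cos_sq θ
  have h1 : f (z - p • x - q • y) = 0 := by
    simp only [map_sub, map_smul, hf, hfy, smul_eq_mul]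
    apply mul_right_cancel₀ hs
    linear_combination -2 * hp' + 2 * cos θ * hq' + 2 * f z * hcs
  have h2 : g (z - p • x - q • y) = 0 := by
    simp only [map_sub, map_smul, hg, hgx, smul_eq_mul]
    apply mul_right_cancel₀ hs
    linear_combination -2 * hq' + 2 * cos θ * hp' + 2 * g z * hcs
  rw [hz, map_add, map_add, map_smul, map_smul, hx, hy, hfix _ h1 h2]
  rfl

end Reflections

namespace CoxeterMatrix

variable {B : Type*} (M : CoxeterMatrix B)

/-- The coroot of the generator `i` in the geometric representation, whose space has the basis of
simple roots: the linear form taking the value `-2 cos (π / M i j)` at the simple root of `j`.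
Where `M i j = 0` encodes the weight `∞`, the quotient `π / 0` is `0` and the value is `-2`, as it
should be. -/
noncomputable def simpleCoroot (i : B) : Module.Dual ℝ (B →₀ ℝ) :=
  Finsupp.linearCombination ℝ fun j => -2 * Real.cos (Real.pi / M i j)

theorem simpleCoroot_single (i j : B) :
    M.simpleCoroot i (Finsupp.single j 1) = -2 * Real.cos (Real.pi / M i j) := by
  simp [simpleCoroot]

theorem simpleCoroot_single_self (i : B) : M.simpleCoroot i (Finsupp.single i 1) = 2 := by
  simp [simpleCoroot_single]

/-- The reflection by which the generator `i` acts in the geometric representation. -/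
noncomputable def simpleReflection (i : B) : (B →₀ ℝ) ≃ₗ[ℝ] (B →₀ ℝ) :=
  Module.reflection (M.simpleCoroot_single_self i)

theorem simpleReflection_apply (i : B) (v : B →₀ ℝ) :
    M.simpleReflection i v = v - M.simpleCoroot i v • Finsupp.single i 1 :=
  Module.reflection_apply _ _

theorem sin_pi_div_ne_zero {i j : B} (hij : i ≠ j) (h0 : M i j ≠ 0) :
    Real.sin (Real.pi / M i j) ≠ 0 := by
  have h1 : M i j ≠ 1 := M.off_diagonal i j hij
  have h2 : (1 : ℝ) < M i j := by exact_mod_cast (by omega : 1 < M i j)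
  exact (Real.sin_pos_of_pos_of_lt_pi (by positivity) (div_lt_self Real.pi_pos h2)).ne'

theorem isLiftable_simpleReflection : M.IsLiftable M.simpleReflection := by
  intro i j
  rcases eq_or_ne i j with rfl | hij
  · rw [M.diagonal, pow_one]
    exact LinearEquiv.ext fun v =>
      Module.involutive_reflection (M.simpleCoroot_single_self i) v
  rcases eq_or_ne (M i j) 0 with h0 | h0
  · rw [h0, pow_zero]
  · refine Module.reflection_mul_reflection_pow_eq_one (θ := Real.pi / M i j) _ _
      (M.simpleCoroot_single i j) ?_ (M.sin_pi_div_ne_zero hij h0) ?_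
    · rw [M.simpleCoroot_single, M.symmetric]
    · field_simp

theorem sin_smul_simpleReflection_mul_pow_apply (i j : B) (k : ℕ) :
    Real.sin (Real.pi / M i j) •
        ((M.simpleReflection i * M.simpleReflection j) ^ k) (Finsupp.single i 1) =
      Real.sin ((2 * k + 1) * (Real.pi / M i j)) • Finsupp.single i 1 +
        Real.sin (2 * k * (Real.pi / M i j)) • Finsupp.single j 1 :=
  Module.sin_smul_reflection_mul_reflection_pow_apply _ _ (M.simpleCoroot_single i j)
    (by rw [M.simpleCoroot_single, M.symmetric]) k

/-- If the weight of `i` and `j` is infinite, the product of the two reflections acts on the plane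
of the two simple roots by a transvection. -/
theorem simpleReflection_mul_pow_apply_of_eq_zero {i j : B} (h : M i j = 0) (k : ℕ) :
    ((M.simpleReflection i * M.simpleReflection j) ^ k) (Finsupp.single i 1) =
      (2 * k + 1 : ℝ) • Finsupp.single i 1 + (2 * k : ℝ) • Finsupp.single j 1 := by
  induction k with
  | zero => simp
  | succ k ih =>
    have h' : M j i = 0 := by rw [M.symmetric, h]
    rw [pow_succ', LinearEquiv.mul_apply, LinearEquiv.mul_apply, ih]
    simp only [simpleReflection_apply, map_add, map_sub, map_smul, simpleCoroot_single_self,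
      simpleCoroot_single, h, h', Nat.cast_zero, div_zero, Real.cos_zero]
    push_cast
    module

end CoxeterMatrix

namespace CoxeterSystem

variable {B W : Type*} [Group W] {M : CoxeterMatrix B} (cs : CoxeterSystem M W)

/-- The geometric (Tits) representation of a Coxeter group. -/
noncomputable def geometricRep : W →* ((B →₀ ℝ) ≃ₗ[ℝ] (B →₀ ℝ)) :=
  cs.lift ⟨M.simpleReflection, M.isLiftable_simpleReflection⟩

theorem geometricRep_simple (i : B) : cs.geometricRep (cs.simple i) = M.simpleReflection i :=
  cs.lift_apply_simple _ i

/-- The order of `s i * s j` is a multiple of `M i j`; in particular it is infinite if `M i j = 0`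
encodes the weight `∞`. -/
theorem dvd_of_simple_mul_simple_pow_eq_one {i j : B} {k : ℕ}
    (h : (cs.simple i * cs.simple j) ^ k = 1) : M i j ∣ k := by
  have hr : (M.simpleReflection i * M.simpleReflection j) ^ k = 1 := by
    simpa [geometricRep_simple] using congrArg cs.geometricRep h
  rcases eq_or_ne i j with rfl | hij
  · simp
  rcases eq_or_ne (M i j) 0 with h0 | h0
  · have h1 := M.simpleReflection_mul_pow_apply_of_eq_zero h0 k
    rw [hr] at h1
    have h2 := DFunLike.congr_fun h1 j
    simp [hij] at h2
    simp [h2]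
  · have h1 := M.sin_smul_simpleReflection_mul_pow_apply i j k
    have hs := M.sin_pi_div_ne_zero hij h0
    rw [hr] at h1
    have h2 := DFunLike.congr_fun h1 j
    have h3 := DFunLike.congr_fun h1 i
    simp [hij] at h2
    simp [hij.symm] at h3
    rw [add_mul, one_mul, Real.sin_add, ← h2, zero_mul, zero_add] at h3
    have h4 : Real.cos (2 * k * (Real.pi / M i j)) = 1 :=
      mul_right_cancel₀ hs (by rw [one_mul]; exact h3.symm)
    obtain ⟨n, hn⟩ := (Real.cos_eq_one_iff _).1 h4
    have h0' : (M i j : ℝ) ≠ 0 := by exact_mod_cast h0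
    have h5 : (n : ℝ) * M i j = k := by
      field_simp at hn
      exact hn
    have h6 : n * (M i j : ℤ) = k := by exact_mod_cast h5
    exact Int.natCast_dvd_natCast.1 ⟨n, by rw [← h6]; ring⟩

theorem geometricRep_wordProd_apply {i : B} {ω : List B} (hi : i ∉ ω) (v : B →₀ ℝ) :
    cs.geometricRep (cs.wordProd ω) v i = v i := by
  induction ω with
  | nil => simp
  | cons j ω ih =>
    rw [List.mem_cons, not_or] at hi
    rw [wordProd_cons, map_mul, LinearEquiv.mul_apply, geometricRep_simple,
      M.simpleReflection_apply]
    simp [Ne.symm hi.1, ih hi.2]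

/-- A word without the letter `i` preserves the coefficient of the simple root of `i`, which the
generator `i` negates. -/
theorem mem_of_wordProd_eq_simple {i : B} {ω : List B} (h : cs.wordProd ω = cs.simple i) :
    i ∈ ω := by
  by_contra hi
  have h1 := cs.geometricRep_wordProd_apply hi (Finsupp.single i 1)
  rw [h, geometricRep_simple, M.simpleReflection_apply, M.simpleCoroot_single_self] at h1
  norm_num at h1

theorem simple_injective : Function.Injective cs.simple := fun i j h => by
  have := cs.mem_of_wordProd_eq_simple (i := i) (ω := [j]) (by rw [wordProd_singleton, h])
  simpa using this

end CoxeterSystem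

/-! ### The exchange property -/

namespace CoxeterSystem

variable {B W : Type*} [Group W] {M : CoxeterMatrix B} (cs : CoxeterSystem M W)

open Classical in
/-- The permutation by which the generator `i` acts on pairs of a group element `t` and a sign:
it conjugates `t` and flips the sign if `t` is the generator itself. -/
noncomputable def signedConj (i : B) : Equiv.Perm (W × ZMod 2) :=
  Function.Involutive.toPerm
    (fun p => (cs.simple i * p.1 * cs.simple i, p.2 + if p.1 = cs.simple i then 1 else 0)) <| by
    rintro ⟨t, ε⟩
    have h : cs.simple i * t * cs.simple i = cs.simple i ↔ t = cs.simple i := by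
      rw [mul_assoc, mul_eq_left, mul_eq_one_iff_eq_inv, inv_simple]
    ext
    · simp [mul_assoc]
    · simp only [h]
      rw [add_assoc, CharTwo.add_self_eq_zero, add_zero]

open Classical in
theorem signedConj_apply (i : B) (t : W) (ε : ZMod 2) :
    cs.signedConj i (t, ε) =
      (cs.simple i * t * cs.simple i, ε + if t = cs.simple i then 1 else 0) := rfl

open Classical in
theorem signedConj_mul_pow_apply (i j : B) (k : ℕ) (t : W) (ε : ZMod 2) :
    ((cs.signedConj i * cs.signedConj j) ^ k) (t, ε) =
      ((cs.simple i * cs.simple j) ^ k * t * ((cs.simple i * cs.simple j) ^ k)⁻¹,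
        ε + ∑ n ∈ Finset.range (2 * k),
          if (cs.simple i * cs.simple j) ^ n * t = cs.simple j then 1 else 0) := by
  set r := cs.simple i * cs.simple j with hr
  have hrj : ∀ n : ℕ, cs.simple j * r ^ n = (r ^ n)⁻¹ * cs.simple j := by
    intro n
    have h1 : cs.simple j * r * (cs.simple j)⁻¹ = r⁻¹ := by simp [hr, mul_assoc]
    have h2 : cs.simple j * r ^ n * (cs.simple j)⁻¹ = (r ^ n)⁻¹ := by
      rw [← inv_pow, ← h1, conj_pow]
    rw [← h2, inv_mul_cancel_right]
  induction k with
  | zero => simp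
  | succ k ih =>
    rw [pow_succ', Equiv.Perm.mul_apply, Equiv.Perm.mul_apply, ih, signedConj_apply,
      signedConj_apply, mul_add_one, Finset.sum_range_succ, Finset.sum_range_succ]
    have h1 : r ^ k * t * (r ^ k)⁻¹ = cs.simple j ↔ r ^ (2 * k) * t = cs.simple j := by
      rw [mul_inv_eq_iff_eq_mul, hrj, eq_inv_mul_iff_mul_eq, ← mul_assoc, ← pow_add, two_mul]
    have h2 : cs.simple j * (r ^ k * t * (r ^ k)⁻¹) * cs.simple j = cs.simple i ↔
        r ^ (2 * k + 1) * t = cs.simple j := by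
      have h3 : cs.simple j * (r ^ k * t * (r ^ k)⁻¹) * cs.simple j = cs.simple i ↔
          r ^ k * t * (r ^ k)⁻¹ = r⁻¹ * cs.simple j := by
        rw [mul_assoc, ← eq_inv_mul_iff_mul_eq, ← eq_mul_inv_iff_mul_eq]
        simp [hr, mul_assoc]
      rw [h3, eq_inv_mul_iff_mul_eq, ← mul_assoc, ← mul_assoc, mul_inv_eq_iff_eq_mul, hrj,
        eq_inv_mul_iff_mul_eq, ← pow_succ', ← mul_assoc, ← pow_add]
      ring_nf
    simp only [h1, h2]
    ext
    · simp [pow_succ', hr, mul_assoc]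
    · simp only [add_assoc]

theorem isLiftable_signedConj : M.IsLiftable cs.signedConj := by
  classical
  intro i j
  refine Equiv.ext fun ⟨t, ε⟩ => ?_
  rw [signedConj_mul_pow_apply, simple_mul_simple_pow]
  -- The summand has period `M i j`, so the sum over two periods vanishes.
  have h : ∑ n ∈ Finset.range (2 * M i j),
      (if (cs.simple i * cs.simple j) ^ n * t = cs.simple j then (1 : ZMod 2) else 0) = 0 := by
    rw [two_mul, Finset.sum_range_add]
    simp only [pow_add, simple_mul_simple_pow, one_mul]
    exact CharTwo.add_self_eq_zero _
  rw [h]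
  simp

/-- The action of a Coxeter group on signed group elements; the sign records the parity of the
number of times that an element occurs in the right inversion sequence of a word. -/
noncomputable def signedConjHom : W →* Equiv.Perm (W × ZMod 2) :=
  cs.lift ⟨cs.signedConj, cs.isLiftable_signedConj⟩

open Classical in
theorem signedConjHom_wordProd_apply (ω : List B) (t : W) (ε : ZMod 2) :
    cs.signedConjHom (cs.wordProd ω) (t, ε) =
      (cs.wordProd ω * t * (cs.wordProd ω)⁻¹, ε + ((cs.rightInvSeq ω).count t : ZMod 2)) := by
  induction ω with
  | nil => simp
  | cons i ω ih =>
    rw [wordProd_cons, map_mul, Equiv.Perm.mul_apply, ih]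
    have h : cs.signedConjHom (cs.simple i) = cs.signedConj i := cs.lift_apply_simple _ i
    rw [h, signedConj_apply, rightInvSeq, List.count_cons]
    have h1 : cs.wordProd ω * t * (cs.wordProd ω)⁻¹ = cs.simple i ↔
        (cs.wordProd ω)⁻¹ * cs.simple i * cs.wordProd ω = t := by
      rw [mul_inv_eq_iff_eq_mul, mul_assoc, inv_mul_eq_iff_eq_mul, eq_comm]
    ext
    · simp [mul_assoc]
    · simp [h1, add_assoc]

/-- The parity of the multiplicity of `t` in the right inversion sequence of a word depends only on
the product of the word. -/
theorem mem_rightInvSeq_of_wordProd_eq {ω ω' : List B} (h : cs.wordProd ω = cs.wordProd ω')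
    (hω : (cs.rightInvSeq ω).Nodup) {t : W} (ht : t ∈ cs.rightInvSeq ω) :
    t ∈ cs.rightInvSeq ω' := by
  classical
  have h1 := cs.signedConjHom_wordProd_apply ω t 0
  rw [h, signedConjHom_wordProd_apply, List.count_eq_one_of_mem hω ht] at h1
  have h2 := congrArg Prod.snd h1
  by_contra hn
  rw [List.count_eq_zero_of_not_mem hn] at h2
  simp at h2

/-- An element that occurs once in the inversion sequence of a word occurs in that of every word
with the same product, so no such word can be shorter. -/
theorem isReduced_of_nodup_rightInvSeq {ω : List B} (hω : (cs.rightInvSeq ω).Nodup) :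
    cs.IsReduced ω := by
  obtain ⟨ω', hr, h⟩ := cs.exists_isReduced (cs.wordProd ω)
  refine le_antisymm (cs.length_wordProd_le ω) ?_
  have hsub : cs.rightInvSeq ω ⊆ cs.rightInvSeq ω' :=
    fun t ht => cs.mem_rightInvSeq_of_wordProd_eq h hω ht
  have hlen := (List.subperm_of_subset hω hsub).length_le
  rw [length_rightInvSeq, length_rightInvSeq] at hlen
  rw [h, hr.eq]
  exact hlen

theorem isReduced_of_nodup_leftInvSeq {ω : List B} (hω : (cs.leftInvSeq ω).Nodup) :
    cs.IsReduced ω := by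
  rw [← isReduced_reverse_iff]
  refine cs.isReduced_of_nodup_rightInvSeq ?_
  rw [rightInvSeq_reverse]
  exact List.nodup_reverse.2 hω

/-- The exchange property, for an arbitrary word. -/
theorem exists_wordProd_mul_simple_eq {ω : List B} {i : B}
    (h : cs.IsRightDescent (cs.wordProd ω) i) :
    ∃ n < ω.length, cs.wordProd ω * cs.simple i = cs.wordProd (ω.eraseIdx n) := by
  obtain ⟨ω', hr, h'⟩ := cs.exists_isReduced (cs.wordProd ω * cs.simple i)
  have hω : cs.wordProd (ω'.concat i) = cs.wordProd ω := by
    rw [wordProd_concat, ← h', simple_mul_simple_cancel_right]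
  have hred : cs.IsReduced (ω'.concat i) := by
    unfold IsReduced
    rw [hω, List.length_concat, ← hr.eq, ← h']
    exact (cs.isRightDescent_iff.1 h).symm
  have hmem : cs.simple i ∈ cs.rightInvSeq (ω'.concat i) := by
    rw [rightInvSeq_concat, List.concat_eq_append]
    simp
  obtain ⟨n, hn, hni⟩ := List.getElem_of_mem
    (cs.mem_rightInvSeq_of_wordProd_eq hω hred.nodup_rightInvSeq hmem)
  refine ⟨n, by simpa using hn, ?_⟩
  rw [← wordProd_mul_getD_rightInvSeq, List.getD_eq_getElem _ _ hn, hni]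

/-- A right descent of an element occurs in every word for it. -/
theorem IsRightDescent.mem {ω : List B} {i : B} (h : cs.IsRightDescent (cs.wordProd ω) i) :
    i ∈ ω := by
  obtain ⟨n, -, hn⟩ := cs.exists_wordProd_mul_simple_eq h
  have h1 : cs.wordProd (ω.reverse ++ ω.eraseIdx n) = cs.simple i := by
    rw [wordProd_append, wordProd_reverse, ← hn, inv_mul_cancel_left]
  rcases List.mem_append.1 (cs.mem_of_wordProd_eq_simple h1) with h2 | h2
  · exact List.mem_reverse.1 h2
  · exact List.mem_of_mem_eraseIdx h2

end CoxeterSystem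

/-! ### Dihedral parabolic subgroups -/

namespace CoxeterSystem

variable {B W : Type*} [Group W] {M : CoxeterMatrix B} (cs : CoxeterSystem M W)

/-- Alternating words in two generators are reduced as long as the braid relation allows. -/
theorem isReduced_alternatingWord {i j : B} {k : ℕ} (hk : M i j = 0 ∨ k ≤ M i j) :
    cs.IsReduced (alternatingWord i j k) := by
  have key : ∀ i j : B, (M i j = 0 ∨ k ≤ M i j) →
      cs.IsReduced ((alternatingWord i j (2 * (k + 1))).take k) := by
    intro i j hk
    refine cs.isReduced_of_nodup_leftInvSeq ?_
    rw [leftInvSeq_take, List.nodup_iff_injective_getElem]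
    have main : ∀ a b : ℕ, a < b → b < k →
        cs.wordProd (alternatingWord j i (2 * a + 1)) ≠
          cs.wordProd (alternatingWord j i (2 * b + 1)) := by
      intro a b hab hb heq
      have h1 : ∀ n : ℕ, ¬ Even (2 * n + 1) := fun n => by simp [parity_simps]
      have h2 : ∀ n : ℕ, (2 * n + 1) / 2 = n := fun n => by omega
      rw [prod_alternatingWord_eq_mul_pow, prod_alternatingWord_eq_mul_pow, if_neg (h1 a),
        if_neg (h1 b), h2, h2, mul_right_inj, ← Nat.sub_add_cancel hab.le, pow_add,
        right_eq_mul] at heq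
      have h3 := cs.dvd_of_simple_mul_simple_pow_eq_one heq
      rw [M.symmetric] at h3
      rcases hk with hk | hk
      · rw [hk, zero_dvd_iff] at h3
        omega
      · have := Nat.le_of_dvd (by omega) h3
        omega
    rintro ⟨a, ha⟩ ⟨b, hb⟩ heq
    simp only [List.getElem_take] at heq
    simp only [List.length_take, length_leftInvSeq, length_alternatingWord] at ha hb
    rw [cs.getElem_leftInvSeq_alternatingWord i j _ a (by omega),
      cs.getElem_leftInvSeq_alternatingWord i j _ b (by omega)] at heq
    rcases lt_trichotomy a b with h | h | h
    · exact absurd heq (main a b h (by omega))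
    · exact Fin.ext h
    · exact absurd heq.symm (main b a h (by omega))
  by_cases he : Even k
  · simpa [listTake_alternatingWord i j (k + 1) k (by omega), he] using key i j hk
  · simpa [listTake_alternatingWord j i (k + 1) k (by omega), he] using
      key j i (by rwa [M.symmetric])

/-- If two generators are right descents of `u`, then `u` ends with every alternating word in them
that is reduced. -/
theorem exists_eq_mul_alternatingWord {u : W} (k : ℕ) {i j : B} (hi : cs.IsRightDescent u i)
    (hj : cs.IsRightDescent u j) (hk : M i j = 0 ∨ k ≤ M i j) :
    ∃ v, u = v * cs.wordProd (alternatingWord i j k) ∧ cs.length v + k = cs.length u := by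
  induction k generalizing i j with
  | zero => exact ⟨u, by simp [alternatingWord], by simp⟩
  | succ k ih =>
    obtain ⟨v, hv, hl⟩ := ih hj hi (by rw [M.symmetric]; omega)
    obtain ⟨ω, hω, rfl⟩ := cs.exists_isReduced v
    rw [← wordProd_append] at hv
    rw [hv] at hj
    obtain ⟨n, hn, h⟩ := cs.exists_wordProd_mul_simple_eq hj
    rcases lt_or_ge n ω.length with hlt | hge
    · rw [List.eraseIdx_append_of_lt_length hlt, wordProd_append (ω := ω.eraseIdx n)] at h
      have hu : u = cs.wordProd (ω.eraseIdx n) * cs.wordProd (alternatingWord i j (k + 1)) := by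
        rw [alternatingWord_succ, wordProd_concat, ← mul_assoc, ← h, hv,
          simple_mul_simple_cancel_right]
      refine ⟨_, hu, le_antisymm ?_ ?_⟩
      · have h1 := cs.length_wordProd_le (ω.eraseIdx n)
        rw [List.length_eraseIdx_of_lt hlt] at h1
        rw [hω.eq] at hl
        omega
      · have h1 := cs.length_mul_le (cs.wordProd (ω.eraseIdx n))
          (cs.wordProd (alternatingWord i j (k + 1)))
        have h2 := cs.length_wordProd_le (alternatingWord i j (k + 1))
        rw [length_alternatingWord] at h2
        rw [← hu] at h1
        omega
    · -- Here the next alternating word would have a shorter expression.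
      exfalso
      rw [List.eraseIdx_append_of_length_le hge, wordProd_append, wordProd_append, mul_assoc,
        mul_right_inj, ← wordProd_concat, ← alternatingWord_succ] at h
      have h1 := (cs.isReduced_alternatingWord hk).eq
      rw [List.length_append, length_alternatingWord] at hn
      have h2 := cs.length_wordProd_le
        ((alternatingWord j i k).eraseIdx (n - ω.length))
      rw [List.length_eraseIdx_of_lt (by rw [length_alternatingWord]; omega)] at h2
      rw [length_alternatingWord] at h1 h2
      rw [h] at h1
      omega

theorem ne_zero_of_isRightDescent {u : W} {i j : B} (hi : cs.IsRightDescent u i)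
    (hj : cs.IsRightDescent u j) : M i j ≠ 0 := fun h => by
  obtain ⟨v, -, hl⟩ := cs.exists_eq_mul_alternatingWord (cs.length u + 1) hi hj (Or.inl h)
  omega

theorem le_length_of_isRightDescent {u : W} {i j : B} (hi : cs.IsRightDescent u i)
    (hj : cs.IsRightDescent u j) : M i j ≤ cs.length u := by
  obtain ⟨v, -, hl⟩ := cs.exists_eq_mul_alternatingWord (M i j) hi hj (Or.inr le_rfl)
  omega

theorem eq_braidWord_of_isRightDescent {u : W} {i j : B} (hi : cs.IsRightDescent u i)
    (hj : cs.IsRightDescent u j) (h : cs.length u = M i j) :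
    u = cs.wordProd (braidWord M i j) := by
  obtain ⟨v, hv, hl⟩ := cs.exists_eq_mul_alternatingWord (M i j) hi hj (Or.inr le_rfl)
  have hv1 : v = 1 := cs.length_eq_zero_iff.1 (by omega)
  rw [hv, hv1, one_mul]

theorem length_braidWord (i j : B) : cs.length (cs.wordProd (braidWord M i j)) = M i j := by
  rw [(cs.isReduced_alternatingWord (Or.inr le_rfl)).eq, length_alternatingWord]

theorem isRightDescent_alternatingWord {i j : B} {k : ℕ} (hk0 : k ≠ 0)
    (hk : M i j = 0 ∨ k ≤ M i j) :
    cs.IsRightDescent (cs.wordProd (alternatingWord i j k)) j := by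
  obtain ⟨k, rfl⟩ := Nat.exists_eq_succ_of_ne_zero hk0
  have h1 := (cs.isReduced_alternatingWord hk).eq
  have h2 := cs.length_wordProd_le (alternatingWord j i k)
  unfold IsRightDescent
  rw [h1]
  rw [Nat.succ_eq_add_one, alternatingWord_succ, wordProd_concat, simple_mul_simple_cancel_right]
  simp only [List.length_concat, length_alternatingWord] at h2 ⊢
  omega

theorem isRightDescent_braidWord_right {i j : B} (h : M i j ≠ 0) :
    cs.IsRightDescent (cs.wordProd (braidWord M i j)) j :=
  cs.isRightDescent_alternatingWord h (Or.inr le_rfl)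

theorem isRightDescent_braidWord_left {i j : B} (h : M i j ≠ 0) :
    cs.IsRightDescent (cs.wordProd (braidWord M i j)) i := by
  rw [wordProd_braidWord_eq]
  exact cs.isRightDescent_braidWord_right (by rwa [M.symmetric])

theorem eq_or_eq_of_mem_alternatingWord {i j r : B} {k : ℕ} (h : r ∈ alternatingWord i j k) :
    r = i ∨ r = j := by
  induction k generalizing i j with
  | zero => simp [alternatingWord] at h
  | succ k ih =>
    rw [alternatingWord_succ, List.concat_eq_append, List.mem_append, List.mem_singleton] at h
    rcases h with h | h
    · exact (ih h).symm
    · exact Or.inr h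

end CoxeterSystem

/-! ### Automorphisms of the Cayley graph and their local labels -/

namespace WeightedGraph

variable {V : Type*} (Γ : WeightedGraph V)

/-- The Coxeter system of a weighted graph. -/
abbrev system : CoxeterSystem Γ.coxeterMatrix Γ.CoxeterGroup := Γ.coxeterMatrix.toCoxeterSystem

theorem coxeterMatrix_apply (x y : V) : Γ.coxeterMatrix x y = (Γ.m x y).toNat := rfl

theorem coxeterMatrix_eq_zero_iff {x y : V} : Γ.coxeterMatrix x y = 0 ↔ Γ.m x y = ⊤ := by
  rw [coxeterMatrix_apply, ENat.toNat_eq_zero]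
  refine ⟨fun h => h.resolve_left fun h0 => ?_, Or.inr⟩
  simpa [h0] using Γ.one_le x y

theorem m_eq_of_coxeterMatrix_eq {x y x' y' : V}
    (h : Γ.coxeterMatrix x y = Γ.coxeterMatrix x' y') : Γ.m x y = Γ.m x' y' := by
  by_cases h0 : Γ.m x y = ⊤
  · rw [h0, Γ.coxeterMatrix_eq_zero_iff.1 (h ▸ Γ.coxeterMatrix_eq_zero_iff.2 h0)]
  · have h0' : Γ.m x' y' ≠ ⊤ := fun h1 =>
      h0 (Γ.coxeterMatrix_eq_zero_iff.1 (h.trans (Γ.coxeterMatrix_eq_zero_iff.2 h1)))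
    rw [← ENat.natCast_toNat h0, ← ENat.natCast_toNat h0', ← coxeterMatrix_apply, h,
      coxeterMatrix_apply]

theorem coxeterMatrix_eq_of_mem_aut {α : Equiv.Perm V} (hα : α ∈ Γ.Aut) (x y : V) :
    Γ.coxeterMatrix (α x) (α y) = Γ.coxeterMatrix x y :=
  congrArg ENat.toNat (hα x y)

theorem mem_star_iff {x y : V} : y ∈ Γ.star x ↔ Γ.coxeterMatrix x y ≠ 0 := by
  rw [Ne, coxeterMatrix_eq_zero_iff, star, Set.mem_insert_iff, SimpleGraph.mem_neighborSet]
  rcases eq_or_ne x y with rfl | h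
  · simp [(Γ.eq_one_iff x x).2 rfl]
  · rw [Γ.eq_top_iff x y h]
    simp [h.symm]

theorem cayleyGraph_adj {v w : Γ.CoxeterGroup} :
    Γ.cayleyGraph.Adj v w ↔ ∃ x, w = v * Γ.system.simple x := by
  rw [cayleyGraph, SimpleGraph.mulCayley_adj', ← CoxeterMatrix.toCoxeterSystem_simple]
  constructor
  · rintro ⟨-, -, ⟨x, rfl⟩, h | h⟩
    · exact ⟨x, h.symm⟩
    · exact ⟨x, by rw [h, CoxeterSystem.simple_mul_simple_cancel_right]⟩
  · rintro ⟨x, rfl⟩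
    refine ⟨fun h => ?_, _, ⟨x, rfl⟩, Or.inl rfl⟩
    have h1 := Γ.system.length_simple x
    rw [left_eq_mul.1 h, CoxeterSystem.length_one] at h1
    exact zero_ne_one h1

variable {Γ}

namespace CayleyAut

variable (f : Γ.CayleyAut)

theorem exists_label (w : Γ.CoxeterGroup) (x : V) :
    ∃ y, f (w * Γ.system.simple x) = f w * Γ.system.simple y :=
  Γ.cayleyGraph_adj.1 (f.map_adj_iff.2 (Γ.cayleyGraph_adj.2 ⟨x, rfl⟩))

/-- The label of the edge onto which `f` maps the edge with label `x` at the vertex `w`. -/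
noncomputable def label (w : Γ.CoxeterGroup) (x : V) : V := (exists_label f w x).choose

theorem apply_mul_simple (w : Γ.CoxeterGroup) (x : V) :
    f (w * Γ.system.simple x) = f w * Γ.system.simple (label f w x) :=
  (exists_label f w x).choose_spec

theorem label_eq_iff {w : Γ.CoxeterGroup} {x y : V} :
    label f w x = y ↔ f (w * Γ.system.simple x) = f w * Γ.system.simple y := by
  rw [apply_mul_simple, mul_right_inj, Γ.system.simple_injective.eq_iff]

theorem label_symm_label (w : Γ.CoxeterGroup) (x : V) :
    label f.symm (f w) (label f w x) = x := by
  rw [label_eq_iff, ← apply_mul_simple, RelIso.symm_apply_apply, RelIso.symm_apply_apply]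

theorem label_injective (w : Γ.CoxeterGroup) : Function.Injective (label f w) :=
  Function.LeftInverse.injective (label_symm_label f w)

theorem label_mul_simple_self (w : Γ.CoxeterGroup) (x : V) :
    label f (w * Γ.system.simple x) x = label f w x := by
  rw [label_eq_iff, CoxeterSystem.simple_mul_simple_cancel_right, apply_mul_simple,
    CoxeterSystem.simple_mul_simple_cancel_right]

theorem length_inv_mul_le (v w : Γ.CoxeterGroup) :
    Γ.system.length ((f v)⁻¹ * f w) ≤ Γ.system.length (v⁻¹ * w) := by
  have key : ∀ (ω : List V) (v : Γ.CoxeterGroup),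
      Γ.system.length ((f v)⁻¹ * f (v * Γ.system.wordProd ω)) ≤ ω.length := by
    intro ω
    induction ω with
    | nil => intro v; simp
    | cons i ω ih =>
      intro v
      have h : (f v)⁻¹ * f (v * Γ.system.wordProd (i :: ω)) = Γ.system.simple (label f v i) *
          ((f (v * Γ.system.simple i))⁻¹ *
            f (v * Γ.system.simple i * Γ.system.wordProd ω)) := by
        have h1 : (f v)⁻¹ =
            Γ.system.simple (label f v i) * (f (v * Γ.system.simple i))⁻¹ := by
          rw [apply_mul_simple, mul_inv_rev, CoxeterSystem.inv_simple,
            CoxeterSystem.simple_mul_simple_cancel_left]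
        rw [CoxeterSystem.wordProd_cons, ← mul_assoc v, h1, mul_assoc]
      rw [h]
      refine (Γ.system.length_mul_le _ _).trans ?_
      rw [Γ.system.length_simple, List.length_cons, add_comm]
      exact Nat.add_le_add_right (ih _) 1
  obtain ⟨ω, hω, h⟩ := Γ.system.exists_isReduced (v⁻¹ * w)
  rw [h, hω.eq]
  simpa [← h] using key ω v

/-- An automorphism preserves the word metric. -/
theorem length_inv_mul (v w : Γ.CoxeterGroup) :
    Γ.system.length ((f v)⁻¹ * f w) = Γ.system.length (v⁻¹ * w) := by
  refine le_antisymm (length_inv_mul_le f v w) ?_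
  simpa using length_inv_mul_le f.symm (f v) (f w)

/-- The label `x` at `w` is a right descent of `v⁻¹ * w` if and only if the edge labelled `x` at `w`
leads towards `v`, which an isometry preserves. -/
theorem isRightDescent_label_iff (v w : Γ.CoxeterGroup) (x : V) :
    Γ.system.IsRightDescent ((f v)⁻¹ * f w) (label f w x) ↔
      Γ.system.IsRightDescent (v⁻¹ * w) x := by
  unfold CoxeterSystem.IsRightDescent
  rw [mul_assoc, ← apply_mul_simple, length_inv_mul, length_inv_mul, ← mul_assoc]

/-- The weight of `x` and `y` is the least distance from `w` of a vertex to which geodesics start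
along the edges labelled `x` and `y`, so it cannot grow under an automorphism. -/
theorem coxeterMatrix_label_le {w : Γ.CoxeterGroup} {x y : V} (h : Γ.coxeterMatrix x y ≠ 0) :
    Γ.coxeterMatrix (label f w x) (label f w y) ≠ 0 ∧
      Γ.coxeterMatrix (label f w x) (label f w y) ≤ Γ.coxeterMatrix x y := by
  set u := Γ.system.wordProd (CoxeterSystem.braidWord Γ.coxeterMatrix x y) with hu
  have hw : (w * u⁻¹)⁻¹ * w = u := by simp
  have hx : Γ.system.IsRightDescent ((f (w * u⁻¹))⁻¹ * f w) (label f w x) := by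
    rw [isRightDescent_label_iff, hw]
    exact Γ.system.isRightDescent_braidWord_left h
  have hy : Γ.system.IsRightDescent ((f (w * u⁻¹))⁻¹ * f w) (label f w y) := by
    rw [isRightDescent_label_iff, hw]
    exact Γ.system.isRightDescent_braidWord_right h
  refine ⟨Γ.system.ne_zero_of_isRightDescent hx hy,
    (Γ.system.le_length_of_isRightDescent hx hy).trans ?_⟩
  rw [length_inv_mul, hw, hu, CoxeterSystem.length_braidWord]

theorem coxeterMatrix_label (w : Γ.CoxeterGroup) (x y : V) :
    Γ.coxeterMatrix (label f w x) (label f w y) = Γ.coxeterMatrix x y := by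
  have hback : Γ.coxeterMatrix (label f w x) (label f w y) ≠ 0 →
      Γ.coxeterMatrix x y ≠ 0 ∧
        Γ.coxeterMatrix x y ≤ Γ.coxeterMatrix (label f w x) (label f w y) := fun h => by
    have := coxeterMatrix_label_le f.symm (w := f w) h
    rwa [label_symm_label, label_symm_label] at this
  by_cases h : Γ.coxeterMatrix x y = 0
  · rw [h]
    by_contra h'
    exact (hback h').1 h
  · obtain ⟨h1, h2⟩ := coxeterMatrix_label_le f (w := w) h
    exact le_antisymm h2 (hback h1).2

/-- The permutation of the labels that an automorphism induces at a vertex. -/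
noncomputable def labelPerm (w : Γ.CoxeterGroup) : Equiv.Perm V where
  toFun := label f w
  invFun := label f.symm (f w)
  left_inv := label_symm_label f w
  right_inv x := by simpa using label_symm_label f.symm (f w) x

theorem labelPerm_mem_aut (w : Γ.CoxeterGroup) : labelPerm f w ∈ Γ.Aut := fun x y =>
  Γ.m_eq_of_coxeterMatrix_eq (coxeterMatrix_label f w x y)

/-- The local permutations at the ends of an edge labelled `x` agree on the star of `x`. -/
theorem label_mul_simple_of_mem_star (w : Γ.CoxeterGroup) {x y : V} (hy : y ∈ Γ.star x) :
    label f (w * Γ.system.simple x) y = label f w y := by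
  rcases eq_or_ne y x with rfl | hxy
  · exact label_mul_simple_self f w y
  have h0 : Γ.coxeterMatrix x y ≠ 0 := Γ.mem_star_iff.1 hy
  have h1 : Γ.coxeterMatrix x y ≠ 1 := Γ.coxeterMatrix.off_diagonal x y hxy.symm
  obtain ⟨k, hk⟩ : ∃ k, Γ.coxeterMatrix x y = k + 2 := ⟨_, (Nat.sub_add_cancel (by omega)).symm⟩
  have hk' : Γ.coxeterMatrix y x = k + 2 := by rw [Γ.coxeterMatrix.symmetric, hk]
  set x' := label f w x with hx'
  set y' := label f w y with hy'
  have hl : Γ.coxeterMatrix y' x' = k + 2 := by rw [hx', hy', coxeterMatrix_label, hk']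
  -- `v` is opposite to `w` in the cycle through `w` with the labels `x` and `y`.
  set u := Γ.system.wordProd (CoxeterSystem.braidWord Γ.coxeterMatrix y x) with hu
  set v := w * u⁻¹ with hv
  have hw : v⁻¹ * w = u := by simp [hv]
  have hdx : Γ.system.IsRightDescent ((f v)⁻¹ * f w) x' := by
    rw [isRightDescent_label_iff, hw]
    exact Γ.system.isRightDescent_braidWord_right (by omega)
  have hdy : Γ.system.IsRightDescent ((f v)⁻¹ * f w) y' := by
    rw [isRightDescent_label_iff, hw]
    exact Γ.system.isRightDescent_braidWord_left (by omega)
  have hlen : Γ.system.length ((f v)⁻¹ * f w) = Γ.coxeterMatrix y' x' := by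
    rw [length_inv_mul, hw, hu, CoxeterSystem.length_braidWord, hk', hl]
  -- Hence the image of `v` is opposite to `f w` in the cycle with the labels `x'` and `y'`.
  have hfu : (f v)⁻¹ * f w = Γ.system.wordProd (CoxeterSystem.alternatingWord y' x' (k + 2)) := by
    rw [Γ.system.eq_braidWord_of_isRightDescent hdy hdx hlen, CoxeterSystem.braidWord, hl]
  have hfu' : (f v)⁻¹ * f (w * Γ.system.simple x) =
      Γ.system.wordProd (CoxeterSystem.alternatingWord x' y' (k + 1)) := by
    rw [apply_mul_simple, ← mul_assoc, hfu, CoxeterSystem.alternatingWord_succ,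
      CoxeterSystem.wordProd_concat, CoxeterSystem.simple_mul_simple_cancel_right]
  have hd : Γ.system.IsRightDescent ((f v)⁻¹ * f (w * Γ.system.simple x))
      (label f (w * Γ.system.simple x) y) := by
    rw [isRightDescent_label_iff, ← mul_assoc, hw, hu, CoxeterSystem.braidWord, hk',
      CoxeterSystem.alternatingWord_succ, CoxeterSystem.wordProd_concat,
      CoxeterSystem.simple_mul_simple_cancel_right]
    exact Γ.system.isRightDescent_alternatingWord (by omega) (Or.inr (by omega))
  rw [hfu'] at hd
  rcases CoxeterSystem.eq_or_eq_of_mem_alternatingWord hd.mem with h | h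
  · have h2 := label_mul_simple_self f w x
    exact absurd (label_injective f _ (h.trans h2.symm)) hxy
  · exact h

/-- If automorphisms of `Γ` are determined by their restrictions to any star, then an automorphism
of the Cayley graph is determined by its restriction to the ball of radius one. -/
theorem eq_one_of_rigid (hΓ : ∀ x : V, ∀ α ∈ Γ.Aut, (∀ y ∈ Γ.star x, α y = y) → α = 1)
    (h1 : f 1 = 1) (hs : ∀ x, f (Γ.system.simple x) = Γ.system.simple x) : f = 1 := by
  have key : ∀ w, f w = w ∧ ∀ y, label f w y = y := by
    intro w
    induction w using Γ.system.simple_induction_right with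
    | one => exact ⟨h1, fun y => by rw [label_eq_iff, one_mul, h1, one_mul, hs]⟩
    | mul_simple_right w x ih =>
      refine ⟨by rw [apply_mul_simple, ih.1, ih.2], ?_⟩
      have h2 := hΓ x (labelPerm f (w * Γ.system.simple x)) (labelPerm_mem_aut f _)
        fun y hy => (label_mul_simple_of_mem_star f w hy).trans (ih.2 y)
      exact fun y => DFunLike.congr_fun h2 y
  exact RelIso.ext fun w => (key w).1

end CayleyAut

end WeightedGraph

/-! ### Cosets of maximal parabolic subgroups -/

namespace CoxeterSystem

variable {B W : Type*} [Group W] {M : CoxeterMatrix B} (cs : CoxeterSystem M W)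

theorem finite_setOf_length_le [Finite B] (n : ℕ) : {w : W | cs.length w ≤ n}.Finite := by
  refine ((List.finite_length_le B n).image cs.wordProd).subset fun w hw => ?_
  obtain ⟨ω, hω, rfl⟩ := cs.exists_isReduced w
  exact ⟨ω, by simpa [hω.eq] using hw, rfl⟩

/-- The maximal parabolic subgroup of the generator `i`: the subgroup generated by all generators
except `i`. -/
def maximalParabolic (i : B) : Subgroup W := Subgroup.closure (cs.simple '' {i}ᶜ)

theorem simple_mem_maximalParabolic {i j : B} (h : j ≠ i) :
    cs.simple j ∈ cs.maximalParabolic i :=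
  Subgroup.subset_closure ⟨j, h, rfl⟩

theorem geometricRep_apply_of_mem_maximalParabolic {i : B} {g : W}
    (hg : g ∈ cs.maximalParabolic i) (v : B →₀ ℝ) : cs.geometricRep g v i = v i := by
  induction hg using Subgroup.closure_induction generalizing v with
  | mem g hg =>
    obtain ⟨j, hj, rfl⟩ := hg
    simpa using cs.geometricRep_wordProd_apply (i := i) (ω := [j])
      (by simpa using Ne.symm hj) v
  | one => simp
  | mul g h _ _ ihg ihh => rw [map_mul, LinearEquiv.mul_apply, ihg, ihh]
  | inv g _ ih =>
    rw [← ih (cs.geometricRep g⁻¹ v), ← LinearEquiv.mul_apply, ← map_mul, mul_inv_cancel, map_one,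
      LinearEquiv.coe_one, id]

/-- If the weight of `i` and `j` is infinite, no power of `s i * s j` is in the parabolic subgroup
omitting `i`, so this subgroup has infinite index. -/
theorem simple_mul_simple_pow_notMem_maximalParabolic {i j : B} (h : M i j = 0) {k : ℕ}
    (hk : k ≠ 0) : (cs.simple i * cs.simple j) ^ k ∉ cs.maximalParabolic i := fun hmem => by
  have hij : j ≠ i := by
    rintro rfl
    simp at h
  have h1 := cs.geometricRep_apply_of_mem_maximalParabolic hmem (Finsupp.single i 1)
  rw [map_pow, map_mul, geometricRep_simple, geometricRep_simple,
    M.simpleReflection_mul_pow_apply_of_eq_zero h] at h1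
  simp [hij, hk] at h1

/-- If the weight of `i` and `j` is infinite, some coset of the parabolic subgroup omitting `i`
misses a given ball. -/
theorem exists_coset_disjoint_ball [Finite B] {i j : B} (h : M i j = 0) (n : ℕ) :
    ∃ g : W, ∀ w, cs.length w ≤ n → g⁻¹ * w ∉ cs.maximalParabolic i := by
  by_contra! hcon
  choose w hw hmem using fun k : ℕ => hcon ((cs.simple i * cs.simple j) ^ k)
  have hne : ∀ a b : ℕ, a < b → w a ≠ w b := by
    intro a b hab heq
    have h1 := mul_mem (hmem a) (inv_mem (hmem b))
    rw [heq, mul_inv_rev, inv_inv, mul_assoc, mul_inv_cancel_left, ← Nat.add_sub_cancel' hab.le,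
      pow_add, inv_mul_cancel_left] at h1
    exact cs.simple_mul_simple_pow_notMem_maximalParabolic h (by omega) h1
  have hinj : Function.Injective w := fun a b heq => by
    rcases lt_trichotomy a b with hab | hab | hab
    · exact absurd heq (hne a b hab)
    · exact hab
    · exact absurd heq.symm (hne b a hab)
  exact Set.infinite_of_injective_forall_mem hinj hw (cs.finite_setOf_length_le n)

end CoxeterSystem

/-! ### Automorphisms of the Cayley graph with prescribed labels -/

namespace WeightedGraph

variable {V : Type*} {Γ : WeightedGraph V}

/-- A labelling assigns to each vertex of the Cayley graph an automorphism of `Γ`, in such a way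
that the automorphisms at the ends of an edge labelled `x` agree on the star of `x`. -/
structure Labelling (Γ : WeightedGraph V) where
  /-- The permutation of the labels at a vertex. -/
  perm : Γ.CoxeterGroup → Equiv.Perm V
  mem_aut : ∀ w, perm w ∈ Γ.Aut
  perm_mul_simple : ∀ w x, ∀ y ∈ Γ.star x, perm (w * Γ.system.simple x) y = perm w y

namespace Labelling

variable (σ : Γ.Labelling)

theorem perm_mul_simple_self (w : Γ.CoxeterGroup) (x : V) :
    σ.perm (w * Γ.system.simple x) x = σ.perm w x :=
  σ.perm_mul_simple w x x (Set.mem_insert x _)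

/-- The permutation of pairs of vertices which moves the first one along the edge with label `x`
and the second one along the edge with the label prescribed by the labelling at the first one. -/
noncomputable def step (x : V) : Equiv.Perm (Γ.CoxeterGroup × Γ.CoxeterGroup) :=
  Function.Involutive.toPerm
    (fun p => (p.1 * Γ.system.simple x, p.2 * Γ.system.simple (σ.perm p.1 x))) fun p => by
      simp only [perm_mul_simple_self, CoxeterSystem.simple_mul_simple_cancel_right]

theorem step_apply (x : V) (u v : Γ.CoxeterGroup) :
    σ.step x (u, v) = (u * Γ.system.simple x, v * Γ.system.simple (σ.perm u x)) := rfl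

theorem step_mul_step_pow_apply {x y : V} (h : Γ.coxeterMatrix x y ≠ 0) (k : ℕ)
    (u v : Γ.CoxeterGroup) :
    ((σ.step x * σ.step y) ^ k) (u, v) =
      (u * (Γ.system.simple y * Γ.system.simple x) ^ k,
        v * (Γ.system.simple (σ.perm u y) * Γ.system.simple (σ.perm u x)) ^ k) := by
  have hx : x ∈ Γ.star y := Γ.mem_star_iff.2 (by rwa [Γ.coxeterMatrix.symmetric])
  have hy : y ∈ Γ.star x := Γ.mem_star_iff.2 h
  induction k generalizing u v with
  | zero => simp
  | succ k ih =>
    rw [pow_succ, Equiv.Perm.mul_apply, Equiv.Perm.mul_apply, step_apply, step_apply, ih,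
      σ.perm_mul_simple_self, σ.perm_mul_simple _ x y hy, σ.perm_mul_simple_self,
      σ.perm_mul_simple _ y x hx, pow_succ', pow_succ']
    simp only [mul_assoc]

/-- Along the residue spanned by the labels `x` and `y` the labelling is constant on `x` and `y`,
and it preserves their weight, so both components satisfy the Coxeter relation. -/
theorem isLiftable_step : Γ.coxeterMatrix.IsLiftable σ.step := by
  intro x y
  by_cases h : Γ.coxeterMatrix x y = 0
  · rw [h, pow_zero]
  · refine Equiv.ext fun ⟨u, v⟩ => ?_
    rw [step_mul_step_pow_apply σ h, CoxeterSystem.simple_mul_simple_pow',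
      ← Γ.coxeterMatrix_eq_of_mem_aut (σ.mem_aut u) x y, CoxeterSystem.simple_mul_simple_pow']
    simp

/-- The action of the Coxeter group on pairs of vertices by simultaneous steps. -/
noncomputable def stepHom : Γ.CoxeterGroup →* Equiv.Perm (Γ.CoxeterGroup × Γ.CoxeterGroup) :=
  Γ.system.lift ⟨σ.step, σ.isLiftable_step⟩

/-- The map of the vertices of the Cayley graph that fixes `1` and has the prescribed labels. -/
noncomputable def toFun (w : Γ.CoxeterGroup) : Γ.CoxeterGroup := (σ.stepHom w⁻¹ (1, 1)).2

theorem stepHom_mul_simple (w : Γ.CoxeterGroup) (x : V) :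
    σ.stepHom (w * Γ.system.simple x)⁻¹ (1, 1) = σ.step x (σ.stepHom w⁻¹ (1, 1)) := by
  have h : σ.stepHom (Γ.system.simple x) = σ.step x := Γ.system.lift_apply_simple _ x
  rw [mul_inv_rev, CoxeterSystem.inv_simple, map_mul, Equiv.Perm.mul_apply, h]

theorem stepHom_apply_fst (w : Γ.CoxeterGroup) : (σ.stepHom w⁻¹ (1, 1)).1 = w := by
  induction w using Γ.system.simple_induction_right with
  | one => simp
  | mul_simple_right w x ih =>
    rw [stepHom_mul_simple, ← Prod.mk.eta (p := σ.stepHom w⁻¹ (1, 1)), step_apply, ih]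

theorem toFun_one : σ.toFun 1 = 1 := by simp [toFun]

theorem toFun_mul_simple (w : Γ.CoxeterGroup) (x : V) :
    σ.toFun (w * Γ.system.simple x) = σ.toFun w * Γ.system.simple (σ.perm w x) := by
  rw [toFun, stepHom_mul_simple, ← Prod.mk.eta (p := σ.stepHom w⁻¹ (1, 1)), step_apply,
    stepHom_apply_fst, toFun]

theorem length_toFun_le (w : Γ.CoxeterGroup) :
    Γ.system.length (σ.toFun w) ≤ Γ.system.length w := by
  obtain ⟨ω, hω, rfl⟩ := Γ.system.exists_isReduced w
  rw [hω.eq]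
  clear hω
  induction ω using List.reverseRecOn with
  | nil => simp [toFun_one]
  | append_singleton ω x ih =>
    rw [CoxeterSystem.wordProd_append, CoxeterSystem.wordProd_singleton, toFun_mul_simple]
    refine (Γ.system.length_mul_le _ _).trans ?_
    rw [Γ.system.length_simple, List.length_append, List.length_singleton]
    exact Nat.add_le_add_right ih 1

/-- Paths starting at `1` lift along the map, with the same length. -/
theorem exists_toFun_eq (v : Γ.CoxeterGroup) :
    ∃ w, σ.toFun w = v ∧ Γ.system.length w ≤ Γ.system.length v := by
  obtain ⟨ω, hω, rfl⟩ := Γ.system.exists_isReduced v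
  rw [hω.eq]
  clear hω
  induction ω using List.reverseRecOn with
  | nil => exact ⟨1, by simp [toFun_one]⟩
  | append_singleton ω x ih =>
    obtain ⟨w, hw, hl⟩ := ih
    refine ⟨w * Γ.system.simple ((σ.perm w).symm x), ?_, ?_⟩
    · rw [toFun_mul_simple, Equiv.apply_symm_apply, hw, CoxeterSystem.wordProd_append,
        CoxeterSystem.wordProd_singleton]
    · refine (Γ.system.length_mul_le _ _).trans ?_
      rw [Γ.system.length_simple, List.length_append, List.length_singleton]
      exact Nat.add_le_add_right hl 1

theorem toFun_surjective : Function.Surjective σ.toFun := fun v =>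
  (σ.exists_toFun_eq v).imp fun _ h => h.1

/-- The map maps each ball about `1` onto itself, and the balls are finite. -/
theorem toFun_injective [Finite V] : Function.Injective σ.toFun := by
  intro w w' h
  set n := max (Γ.system.length w) (Γ.system.length w')
  have : Finite {w : Γ.CoxeterGroup | Γ.system.length w ≤ n} :=
    (Γ.system.finite_setOf_length_le n).to_subtype
  have hmaps : Set.MapsTo σ.toFun {w | Γ.system.length w ≤ n} {w | Γ.system.length w ≤ n} :=
    fun w hw => (σ.length_toFun_le w).trans hw
  have hsurj : Function.Surjective (hmaps.restrict) := by
    rintro ⟨v, hv⟩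
    obtain ⟨w, hw, hl⟩ := σ.exists_toFun_eq v
    exact ⟨⟨w, hl.trans hv⟩, Subtype.ext hw⟩
  have hinj := Finite.injective_iff_surjective.2 hsurj
  have hw : w ∈ {w | Γ.system.length w ≤ n} := by simp [n]
  have hw' : w' ∈ {w | Γ.system.length w ≤ n} := by simp [n]
  exact congrArg Subtype.val (@hinj ⟨w, hw⟩ ⟨w', hw'⟩ (Subtype.ext h))

/-- The automorphism of the Cayley graph that fixes `1` and has the prescribed labels. -/
noncomputable def cayleyAut [Finite V] : Γ.CayleyAut where
  toEquiv := Equiv.ofBijective σ.toFun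
    ⟨σ.toFun_injective, σ.toFun_surjective⟩
  map_rel_iff' {v w} := by
    change Γ.cayleyGraph.Adj (σ.toFun v) (σ.toFun w) ↔ _
    rw [cayleyGraph_adj, cayleyGraph_adj]
    constructor
    · rintro ⟨x, hx⟩
      refine ⟨(σ.perm v).symm x, σ.toFun_injective ?_⟩
      rw [hx, toFun_mul_simple, Equiv.apply_symm_apply]
    · rintro ⟨x, rfl⟩
      exact ⟨σ.perm v x, σ.toFun_mul_simple v x⟩

theorem cayleyAut_apply [Finite V] (w : Γ.CoxeterGroup) : σ.cayleyAut w = σ.toFun w := rfl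

open Classical in
/-- The labelling by an automorphism `α` of `Γ` on the coset of `g` of the parabolic subgroup
omitting `x`, and by the identity elsewhere. Only edges labelled `x` leave the coset. -/
noncomputable def ofCoset (x : V) (α : Equiv.Perm V) (hα : α ∈ Γ.Aut)
    (hfix : ∀ y ∈ Γ.star x, α y = y) (g : Γ.CoxeterGroup) : Γ.Labelling where
  perm w := if g⁻¹ * w ∈ Γ.system.maximalParabolic x then α else 1
  mem_aut w := by
    split_ifs
    · exact hα
    · exact one_mem _
  perm_mul_simple w z y hy := by
    rcases eq_or_ne z x with rfl | hz
    · split_ifs <;> simp [hfix y hy]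
    · have h : g⁻¹ * (w * Γ.system.simple z) ∈ Γ.system.maximalParabolic x ↔
          g⁻¹ * w ∈ Γ.system.maximalParabolic x := by
        rw [← mul_assoc]
        exact Subgroup.mul_mem_cancel_right _ (Γ.system.simple_mem_maximalParabolic hz)
      simp only [h]

end Labelling

/-- A nontrivial automorphism of `Γ` fixing a star gives nontrivial automorphisms of the Cayley
graph fixing arbitrarily large balls. -/
theorem CayleyAut.exists_ne_one_fixing_ball [Finite V] {x : V} {α : Equiv.Perm V}
    (hα : α ∈ Γ.Aut) (h1 : α ≠ 1) (hfix : ∀ y ∈ Γ.star x, α y = y) (n : ℕ) :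
    ∃ f : Γ.CayleyAut, f ≠ 1 ∧ ∀ w, Γ.system.length w ≤ n → f w = w := by
  obtain ⟨y, hy⟩ : ∃ y, α y ≠ y := by
    by_contra! h
    exact h1 (Equiv.ext h)
  have hxy : Γ.coxeterMatrix x y = 0 := by
    by_contra h
    exact hy (hfix y (Γ.mem_star_iff.2 h))
  obtain ⟨g, hg⟩ := Γ.system.exists_coset_disjoint_ball hxy n
  set σ := Labelling.ofCoset x α hα hfix g with hσ
  refine ⟨σ.cayleyAut, fun h => ?_, fun w hw => ?_⟩
  · have hf : ∀ w, σ.toFun w = w := fun w => DFunLike.congr_fun h w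
    have hp : σ.perm g = α := if_pos (by rw [inv_mul_cancel]; exact one_mem _)
    have h2 := σ.toFun_mul_simple g y
    rw [hf, hf, hp, mul_right_inj] at h2
    exact hy (Γ.system.simple_injective h2).symm
  · rw [Labelling.cayleyAut_apply]
    obtain ⟨ω, hω, rfl⟩ := Γ.system.exists_isReduced w
    rw [hω.eq] at hw
    clear hω
    induction ω using List.reverseRecOn with
    | nil => simp [Labelling.toFun_one]
    | append_singleton ω z ih =>
      rw [List.length_append, List.length_singleton] at hw
      have hp : σ.perm (Γ.system.wordProd ω) = 1 :=
        if_neg (hg _ ((Γ.system.length_wordProd_le ω).trans (by omega)))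
      rw [CoxeterSystem.wordProd_append, CoxeterSystem.wordProd_singleton,
        Labelling.toFun_mul_simple, ih (by omega), hp, Equiv.Perm.one_apply]

end WeightedGraph

/-! ### The permutation topology -/

section PermutationTopology

open Filter Topology

variable {G X : Type*} [Group G] [MulAction G X]

theorem permutationTopology.mem_nhds_iff {g : G} {U : Set G} :
    U ∈ @nhds G (permutationTopology G X) g ↔
      ∃ F : Finset X, ∀ f : G, (∀ x ∈ F, f • x = g • x) → f ∈ U := by
  let := permutationTopology G X
  rw [_root_.mem_nhds_iff]
  constructor
  · rintro ⟨t, htU, ht, hg⟩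
    obtain ⟨F, hF⟩ := ht g hg
    exact ⟨F, fun f hf => htU (hF f hf)⟩
  · rintro ⟨F, hF⟩
    exact ⟨{f | ∀ x ∈ F, f • x = g • x}, hF,
      fun f hf => ⟨F, fun f' hf' x hx => (hf' x hx).trans (hf x hx)⟩, fun _ _ => rfl⟩

/-- Convergence in the permutation topology is pointwise eventual equality. -/
theorem permutationTopology.tendsto_iff {ι : Type*} {l : Filter ι} {φ : ι → G} {g : G} :
    Tendsto φ l (@nhds G (permutationTopology G X) g) ↔ ∀ x : X, ∀ᶠ i in l, φ i • x = g • x := by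
  let := permutationTopology G X
  constructor
  · intro h x
    exact h (permutationTopology.mem_nhds_iff.2 ⟨{x}, fun f hf => hf x (by simp)⟩)
  · intro h U hU
    obtain ⟨F, hF⟩ := permutationTopology.mem_nhds_iff.1 hU
    rw [mem_map]
    filter_upwards [(eventually_all_finset F).2 fun x _ => h x] with i hi
    exact hF _ hi

theorem permutationTopology.eventually_smul_eq (g : G) (x : X) :
    ∀ᶠ f in @nhds G (permutationTopology G X) g, f • x = g • x :=
  permutationTopology.tendsto_iff.1 tendsto_id x

variable (G X) in
theorem permutationTopology.isTopologicalGroup :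
    @IsTopologicalGroup G (permutationTopology G X) _ := by
  let := permutationTopology G X
  refine { continuous_mul := continuous_iff_continuousAt.2 fun p => ?_,
           continuous_inv := continuous_iff_continuousAt.2 fun g => ?_ }
  · refine permutationTopology.tendsto_iff.2 fun x => ?_
    rw [nhds_prod_eq]
    filter_upwards [(permutationTopology.eventually_smul_eq p.1 (p.2 • x)).prod_mk
      (permutationTopology.eventually_smul_eq p.2 x)] with q hq
    rw [mul_smul, mul_smul, hq.2, hq.1]
  · refine permutationTopology.tendsto_iff.2 fun x => ?_
    filter_upwards [permutationTopology.eventually_smul_eq g (g⁻¹ • x)] with f hf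
    rw [inv_smul_eq_iff, hf, smul_inv_smul]

variable (G X) in
theorem permutationTopology.exists_continuous_injective [FaithfulSMul G X] [TopologicalSpace X]
    [DiscreteTopology X] :
    @Continuous G (X → X) (permutationTopology G X) _ (fun g x => g • x) ∧
      Function.Injective (fun (g : G) (x : X) => g • x) := by
  let := permutationTopology G X
  refine ⟨continuous_pi fun x => continuous_iff_continuousAt.2 fun g => ?_, fun g h hgh =>
    FaithfulSMul.eq_of_smul_eq_smul fun x => congrFun hgh x⟩
  unfold ContinuousAt
  rw [nhds_discrete X, tendsto_pure]
  exact permutationTopology.eventually_smul_eq g x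

variable (G X) in
theorem permutationTopology.t2Space [FaithfulSMul G X] :
    @T2Space G (permutationTopology G X) := by
  let := permutationTopology G X
  let : TopologicalSpace X := ⊥
  have : DiscreteTopology X := ⟨rfl⟩
  obtain ⟨hc, hi⟩ := permutationTopology.exists_continuous_injective G X
  exact T2Space.of_injective_continuous hi hc

variable (G X) in
theorem permutationTopology.totallyDisconnectedSpace [FaithfulSMul G X] :
    @TotallyDisconnectedSpace G (permutationTopology G X) := by
  let := permutationTopology G X
  let : TopologicalSpace X := ⊥
  have : DiscreteTopology X := ⟨rfl⟩
  obtain ⟨hc, hi⟩ := permutationTopology.exists_continuous_injective G X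
  exact ⟨isTotallyDisconnected_of_image hc.continuousOn hi
    (isTotallyDisconnected_of_totallyDisconnectedSpace _)⟩

end PermutationTopology

/-! ### The topological group of automorphisms of the Cayley graph -/

namespace WeightedGraph

open Filter Topology

variable {V : Type*} {Γ : WeightedGraph V}

theorem CayleyAut.length_apply_of_fix_one {f : Γ.CayleyAut} (h : f 1 = 1) (w : Γ.CoxeterGroup) :
    Γ.system.length (f w) = Γ.system.length w := by
  simpa [h] using CayleyAut.length_inv_mul f 1 w

/-- The stabilizer of a vertex is compact: its orbits are finite, so that an ultrafilter on it
determines the images and preimages of all vertices under a limit automorphism. -/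
theorem CayleyAut.isCompact_stabilizer_one [Finite V] :
    IsCompact {f : Γ.CayleyAut | f 1 = 1} := by
  rw [isCompact_iff_ultrafilter_le_nhds]
  intro U hU
  rw [le_principal_iff] at hU
  have hval : ∀ φ : Γ.CayleyAut → Γ.CoxeterGroup, ∀ n,
      (∀ f : Γ.CayleyAut, f 1 = 1 → Γ.system.length (φ f) ≤ n) →
      ∃ v, ∀ᶠ f in (U : Filter Γ.CayleyAut), φ f = v := by
    intro φ n hφ
    have hmem : (⋃ v ∈ {v | Γ.system.length v ≤ n}, {f | φ f = v}) ∈ U := by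
      filter_upwards [hU] with f hf
      exact Set.mem_biUnion (hφ f hf) rfl
    obtain ⟨v, -, hv⟩ := (Ultrafilter.finite_biUnion_mem_iff
      (Γ.system.finite_setOf_length_le n)).1 hmem
    exact ⟨v, hv⟩
  choose a ha using fun w => hval (fun f => f w) (Γ.system.length w) fun f hf =>
    (CayleyAut.length_apply_of_fix_one hf w).le
  choose b hb using fun w => hval (fun f => f.symm w) (Γ.system.length w) fun f hf =>
    (CayleyAut.length_apply_of_fix_one (f := f.symm)
      ((RelIso.symm_apply_eq f).2 hf.symm) w).le
  let g : Γ.CayleyAut :=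
    { toFun := a
      invFun := b
      left_inv := fun w => by
        obtain ⟨f, h1, h2⟩ := ((ha w).and (hb (a w))).exists
        rw [← h2, ← h1, RelIso.symm_apply_apply]
      right_inv := fun w => by
        obtain ⟨f, h1, h2⟩ := ((hb w).and (ha (b w))).exists
        rw [← h2, ← h1, RelIso.apply_symm_apply]
      map_rel_iff' := fun {v w} => by
        obtain ⟨f, h1, h2⟩ := ((ha v).and (ha w)).exists
        change Γ.cayleyGraph.Adj (a v) (a w) ↔ _
        rw [← h1, ← h2]
        exact f.map_adj_iff }
  refine ⟨g, ?_, ?_⟩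
  · obtain ⟨f, h1, h2⟩ := ((ha 1).and hU).exists
    exact h1.symm.trans h2
  · exact permutationTopology.tendsto_iff (φ := id).2 fun w => ha w

theorem CayleyAut.isTDLCGroup [Finite V] (Γ : WeightedGraph V) : IsTDLCGroup Γ.CayleyAut := by
  have hG : IsTopologicalGroup Γ.CayleyAut := permutationTopology.isTopologicalGroup _ _
  refine ⟨hG, permutationTopology.t2Space _ Γ.CoxeterGroup,
    permutationTopology.totallyDisconnectedSpace _ Γ.CoxeterGroup, ?_⟩
  refine CayleyAut.isCompact_stabilizer_one.locallyCompactSpace_of_mem_nhds_of_group (x := 1) ?_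
  exact permutationTopology.eventually_smul_eq (1 : Γ.CayleyAut) (1 : Γ.CoxeterGroup)

/-- If automorphisms of `Γ` are determined by their restrictions to any star, the pointwise
stabilizer of the ball of radius one is trivial. -/
theorem CayleyAut.discreteTopology_of_rigid [Finite V]
    (hΓ : ∀ x : V, ∀ α ∈ Γ.Aut, (∀ y ∈ Γ.star x, α y = y) → α = 1) :
    DiscreteTopology Γ.CayleyAut := by
  classical
  have := Fintype.ofFinite V
  have hG : IsTopologicalGroup Γ.CayleyAut := permutationTopology.isTopologicalGroup _ _
  refine discreteTopology_of_isOpen_singleton_one ?_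
  rintro _ rfl
  refine ⟨insert 1 (Finset.univ.image Γ.system.simple), fun f hf => ?_⟩
  exact CayleyAut.eq_one_of_rigid f hΓ (hf 1 (by simp)) fun x => hf _ (by simp)

theorem CayleyAut.not_discreteTopology [Finite V] {x : V} {α : Equiv.Perm V}
    (hα : α ∈ Γ.Aut) (h1 : α ≠ 1) (hfix : ∀ y ∈ Γ.star x, α y = y) :
    ¬ DiscreteTopology Γ.CayleyAut := by
  intro h
  obtain ⟨F, hF⟩ := isOpen_discrete ({1} : Set Γ.CayleyAut) 1 rfl
  obtain ⟨f, hf, hfw⟩ :=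
    CayleyAut.exists_ne_one_fixing_ball hα h1 hfix (F.sup Γ.system.length)
  exact hf (hF f fun w hw => hfw w (Finset.le_sup hw))

end WeightedGraph

theorem corollaryA {V : Type*} [Finite V] (Γ : WeightedGraph V) :
    IsTDLCGroup Γ.CayleyAut ∧
      (¬ DiscreteTopology Γ.CayleyAut ↔
        ∃ x : V, ∃ α ∈ Γ.Aut, α ≠ 1 ∧ ∀ y ∈ Γ.star x, α y = y) := by
  refine ⟨WeightedGraph.CayleyAut.isTDLCGroup Γ, fun h => ?_, ?_⟩
  · by_contra! hcon
    refine h (WeightedGraph.CayleyAut.discreteTopology_of_rigid fun x α hα hfix => ?_)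
    by_contra h1
    obtain ⟨y, hy, hne⟩ := hcon x α hα h1
    exact hne (hfix y hy)
  · rintro ⟨x, α, hα, h1, hfix⟩
    exact WeightedGraph.CayleyAut.not_discreteTopology hα h1 hfix
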